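/- Let $W\subset\mathbb C$ be an additive subgroup, let $\mu:(W,+)\to(\mathbb C^{*},\cdot)$ be a group morphism, and let $$\Gamma=\Gamma_{W,\mu}=\left\{\begin{bmatrix}\mu(w)^{-2}&0&0\\0&\mu(w)&w\,\mu(w)\\0&0&\mu(w)\end{bmatrix}\;:\;w\in W\right\}\subset \mathrm{PSL}(3,\mathbb C).$$ Suppose that $\Gamma$ is discrete, is not cyclic, and contains a loxodromic element (an element having a lift to $\mathrm{SL}(3,\mathbb C)$ with an eigenvalue of modulus different from $1$). Let $\Gamma$ act on $\mathbb{CP}^2$. Let $L_0(\Gamma)$ be the closure of the set of points with infinite isotropy group, let $L_1(\Gamma)$ be the closure of the set of accumulation points of orbits of points in $\mathbb{CP}^2\setminus L_0(\Gamma)$, and let $L_2(\Gamma)$ be the closure of the set of accumulation points of orbits of compact subsets of $\mathbb{CP}^2\setminus(L_0(\Gamma)\cup L_1(\Gamma))$; here $q$ is an accumulation point of the orbit of a set $K$ if every neighbourhood of $q$ meets $\gamma K$ for infinitely many $\gamma\in\Gamma$. The Kulkarni limit set is $\Lambda_{\mathrm{Kul}}(\Gamma)=L_0(\Gamma)\cup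 L_1(\Gamma)\cup L_2(\Gamma)$. Say that $\mu(W)$ contains rational (resp. irrational) rotations if there is $w\in W\setminus\{0\}$ with $\mu(w)=e^{2\pi i\theta}$ for some $\theta\in\mathbb Q$ (resp. $\theta\in\mathbb R\setminus\mathbb Q$), and distinguish the following cases. * C1.1: $\mu(W)$ contains rational rotations and $W$ is discrete. * C1.2: $\mu(W)$ contains rational rotations and $W$ is not discrete. * C1.3 (resp. C1.4): $\mu(W)$ contains no rational rotations, $W$ is discrete, and $\mu(W)$ contains (resp. does not contain) irrational rotations. * C1.5 (resp. C1.6): $\mu(W)$ contains no rational rotations, $W$ is not discrete, and $\mu(W)$ contains (resp. does not contain) irrational rotations. Condition (F) holds if there is a sequence $(w_k)$ in $W$ with $w_k\to\infty$, $\mu(w_k)\to0$ and $w_k\,\mu(w_k)^3\to b$ for some $b\in\mathbb C^{*}$. Write $e_1,e_2,e_3\in\mathbb{CP}^2$ for the classes of the standard basis vectors of $\mathbb C^3$, and $\overleftrightarrow{p,q}$ for the complex projective line through $p\ne q$. Then $$\Lambda_{\mathrm{Kul}}(\Gamma)=\begin{cases} \{e_1,e_2\} & \text{in cases C1.3 and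 C1.4, if (F) does not hold;}\\ \overleftrightarrow{e_1,e_2} & \text{in cases C1.3 and C1.4, if (F) holds, and in case C1.1;}\\ \{e_1\}\cup\overleftrightarrow{e_2,e_3} & \text{in cases C1.5 and C1.6, if (F) does not hold;}\\ \overleftrightarrow{e_1,e_2}\cup\overleftrightarrow{e_2,e_3} & \text{in cases C1.5 and C1.6, if (F) holds, and in case C1.2.} \end{cases}$$ -/

import Mathlib

open Filter Topology
open scoped LinearAlgebra.Projectivization MatrixGroups

noncomputable section

/-! ### The Kulkarni limit set of a group acting on a topological space -/

namespace Kulkarni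

variable (G : Type*) {X : Type*} [Group G] [MulAction G X] [TopologicalSpace X]

/-- `q` is an accumulation point of the orbit `{g • K}` (indexed by `g : G`) of the set `K`: every
neighbourhood of `q` meets `g • K` for infinitely many `g`. -/
def IsOrbitAccPt (K : Set X) (q : X) : Prop :=
  ∀ U ∈ 𝓝 q, {g : G | ∃ x ∈ K, g • x ∈ U}.Infinite

variable (X)

/-- The closure of the set of points with infinite isotropy group. -/
def L0 : Set X := closure {x : X | Infinite (MulAction.stabilizer G x)}

/-- The closure of the set of accumulation points of orbits of points outside `L0`. -/
def L1 : Set X := closure {q : X | ∃ x ∈ (L0 G X)ᶜ, IsOrbitAccPt G {x} q}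

/-- The closure of the set of accumulation points of orbits of compact sets outside `L0 ∪ L1`. -/
def L2 : Set X :=
  closure {q : X | ∃ K : Set X, IsCompact K ∧ K ⊆ (L0 G X ∪ L1 G X)ᶜ ∧ IsOrbitAccPt G K q}

/-- The Kulkarni limit set. -/
def limitSet : Set X := L0 G X ∪ L1 G X ∪ L2 G X

end Kulkarni

/-! ### The complex projective plane -/

/-- The complex projective plane. -/
abbrev CP2 : Type := ℙ ℂ (Fin 3 → ℂ)

/-- The quotient topology from `ℂ³ ∖ {0}`. -/
instance CP2.instTopologicalSpace : TopologicalSpace CP2 :=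
  TopologicalSpace.coinduced
    (fun v : {v : Fin 3 → ℂ // v ≠ 0} => (Projectivization.mk ℂ v.1 v.2 : CP2)) inferInstance

/-- The points `e₁, e₂, e₃` of the projective plane (indexed by `0, 1, 2`). -/
def CP2.e (i : Fin 3) : CP2 :=
  Projectivization.mk ℂ (Pi.single i (1 : ℂ)) (Pi.single_ne_zero_iff.2 one_ne_zero)

/-- The smallest projective subspace containing `p` and `q`; the complex projective line through
`p` and `q` if these are distinct. -/
def CP2.line (p q : CP2) : Set CP2 :=
  (Projectivization.Subspace.span {p, q} : Projectivization.Subspace ℂ (Fin 3 → ℂ))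

/-- An element of `PSL(3, ℂ)` is loxodromic if it has a lift to `SL(3, ℂ)` with an eigenvalue of
modulus different from `1` (the other elements are the elliptic and the parabolic ones). -/
def IsLoxodromic (g : PSL(3, ℂ)) : Prop :=
  ∃ A : SL(3, ℂ), (QuotientGroup.mk A : PSL(3, ℂ)) = g ∧
    ∃ z : ℂ, Module.End.HasEigenvalue (Matrix.toLin' (A : Matrix (Fin 3) (Fin 3) ℂ)) z ∧ ‖z‖ ≠ 1

/-! ### The groups `Γ_{W,μ}` -/

namespace CaseOne

variable (W : AddSubgroup ℂ) (μ : Multiplicative W →* ℂˣ)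

/-- The value of `μ` at `w`, as a complex number. -/
def val (w : W) : ℂ := (μ (Multiplicative.ofAdd w) : ℂˣ)

theorem val_ne_zero (w : W) : val W μ w ≠ 0 := Units.ne_zero _

theorem val_zero : val W μ 0 = 1 := by simp [val]

theorem val_add (v w : W) : val W μ (v + w) = val W μ v * val W μ w := by simp [val]

/-- The matrix with diagonal `μ(w)⁻², μ(w), μ(w)` and `(2,3)`-entry `w μ(w)`. -/
def mat (w : W) : Matrix (Fin 3) (Fin 3) ℂ :=
  !![(val W μ w ^ 2)⁻¹, 0, 0;
     0, val W μ w, (w : ℂ) * val W μ w;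
     0, 0, val W μ w]

theorem det_mat (w : W) : (mat W μ w).det = 1 := by
  have h := val_ne_zero W μ w
  simp [mat, Matrix.det_fin_three]
  field_simp

theorem mat_add (v w : W) : mat W μ (v + w) = mat W μ v * mat W μ w := by
  ext i j
  fin_cases i <;> fin_cases j <;>
    simp [mat, Matrix.mul_apply, Fin.sum_univ_three, val_add] <;> ring

theorem mat_zero : mat W μ 0 = 1 := by
  ext i j
  fin_cases i <;> fin_cases j <;> simp [mat, val_zero]

/-- `w ↦ mat w` as a homomorphism to `SL(3, ℂ)`. -/
def toSL : Multiplicative W →* SL(3, ℂ) where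
  toFun w := ⟨mat W μ w.toAdd, det_mat W μ w.toAdd⟩
  map_one' := Subtype.ext (mat_zero W μ)
  map_mul' v w := Subtype.ext (mat_add W μ v.toAdd w.toAdd)

/-- The group `Γ_{W,μ}` of the classes in `PSL(3, ℂ)` of the matrices `mat w`, for `w ∈ W`. -/
def group : Subgroup PSL(3, ℂ) :=
  ((QuotientGroup.mk' (Subgroup.center SL(3, ℂ))).comp (toSL W μ)).range

/-- `z = e^{2πiθ}` with `θ` rational. -/
def IsRationalRotation (z : ℂ) : Prop :=
  ∃ θ : ℚ, z = Complex.exp (2 * Real.pi * Complex.I * (θ : ℂ))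

/-- `z = e^{2πiθ}` with `θ` real and irrational. -/
def IsIrrationalRotation (z : ℂ) : Prop :=
  ∃ θ : ℝ, Irrational θ ∧ z = Complex.exp (2 * Real.pi * Complex.I * (θ : ℂ))

/-- `μ(W)` contains rational rotations; the trivial value `μ(0) = 1` does not count. -/
def HasRationalRotations : Prop := ∃ w : W, w ≠ 0 ∧ IsRationalRotation (val W μ w)

/-- `μ(W)` contains irrational rotations. -/
def HasIrrationalRotations : Prop := ∃ w : W, IsIrrationalRotation (val W μ w)

/-- Condition (F). -/
def ConditionF : Prop :=
  ∃ w : ℕ → W, Tendsto (fun k => (w k : ℂ)) atTop (Bornology.cobounded ℂ) ∧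
    Tendsto (fun k => val W μ (w k)) atTop (𝓝 0) ∧
    ∃ b : ℂ, b ≠ 0 ∧ Tendsto (fun k => (w k : ℂ) * val W μ (w k) ^ 3) atTop (𝓝 b)

/-- Case C1.1. -/
def C11 : Prop := HasRationalRotations W μ ∧ DiscreteTopology W

/-- Case C1.2. -/
def C12 : Prop := HasRationalRotations W μ ∧ ¬ DiscreteTopology W

/-- Case C1.3. -/
def C13 : Prop :=
  ¬ HasRationalRotations W μ ∧ DiscreteTopology W ∧ HasIrrationalRotations W μ

/-- Case C1.4. -/
def C14 : Prop :=
  ¬ HasRationalRotations W μ ∧ DiscreteTopology W ∧ ¬ HasIrrationalRotations W μ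

/-- Case C1.5. -/
def C15 : Prop :=
  ¬ HasRationalRotations W μ ∧ ¬ DiscreteTopology W ∧ HasIrrationalRotations W μ

/-- Case C1.6. -/
def C16 : Prop :=
  ¬ HasRationalRotations W μ ∧ ¬ DiscreteTopology W ∧ ¬ HasIrrationalRotations W μ

end CaseOne

end

/-! ### Coordinates on the projective plane -/

namespace CP2

/-! In coordinates `[x : y : z]`, the element given by `w` acts by `[x : μ(w)³(y + wz) : μ(w)³z]`:
it translates `y/z` by `w` and multiplies `z/x` by `μ(w)³`.

The decisive point is that (F) is automatic (`conditionF`), so the cases without (F) are vacuous.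
Discreteness makes the pairs `(log |μ(w)|, w)` finite in number in every bounded region of `ℝ × ℂ`
(`finite_of_discrete`). If they all lay on one real line, projection to the logarithm would make `Γ`
cyclic. Hence some `u`, `v` are independent with `log |μ(u)| ≠ 0`, and combinations `n v + mₙ u` can
be tuned to grow linearly in `n` while `|μ|³` decays like `1/n`.

Condition (F) drives orbits onto every point of the line `z = 0`, and if `W` is not discrete, small
translations make the points of `x = 0` accumulate at themselves; both lines then lie in `L0 ∪ L1`.
Conversely, boundedness of `y/z` bounds `w`, and boundedness of `z/x` and `x/z` bounds `μ(w)` and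
its inverse. Hence compact sets off the line or lines accumulate only there, and
`limitSet_eq_of_isClosed` concludes. Only discreteness of `W` matters, not rotations. -/

theorem exists_mk (p : CP2) : ∃ (v : Fin 3 → ℂ) (hv : v ≠ 0), p = Projectivization.mk ℂ v hv :=
  ⟨p.rep, p.rep_nonzero, p.mk_rep.symm⟩

/-- The points whose `i`-th homogeneous coordinate vanishes. -/
def vanishing (i : Fin 3) : Set CP2 := {p | p.rep i = 0}

/-- The points `p` with `|pᵢ| < R |pⱼ|` in homogeneous coordinates. -/
def dominated (R : ℝ) (i j : Fin 3) : Set CP2 := {p | ‖p.rep i‖ < R * ‖p.rep j‖}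

theorem mk_mem_vanishing (i : Fin 3) {v : Fin 3 → ℂ} (hv : v ≠ 0) :
    Projectivization.mk ℂ v hv ∈ vanishing i ↔ v i = 0 := by
  obtain ⟨a, ha⟩ := Projectivization.exists_smul_eq_mk_rep ℂ v hv
  rw [vanishing, Set.mem_ofPred_eq, ← ha]
  simp [Units.smul_def]

theorem mk_mem_dominated (R : ℝ) (i j : Fin 3) {v : Fin 3 → ℂ} (hv : v ≠ 0) :
    Projectivization.mk ℂ v hv ∈ dominated R i j ↔ ‖v i‖ < R * ‖v j‖ := by
  obtain ⟨a, ha⟩ := Projectivization.exists_smul_eq_mk_rep ℂ v hv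
  have hpos : 0 < ‖(a : ℂ)‖ := norm_pos_iff.2 a.ne_zero
  rw [dominated, Set.mem_ofPred_eq, ← ha]
  simp only [Units.smul_def, Pi.smul_apply, smul_eq_mul, norm_mul]
  rw [mul_left_comm, mul_lt_mul_iff_right₀ hpos]

theorem isOpen_iff (U : Set CP2) :
    IsOpen U ↔ IsOpen {v : {v : Fin 3 → ℂ // v ≠ 0} | Projectivization.mk ℂ v.1 v.2 ∈ U} :=
  isOpen_coinduced

theorem continuous_mk :
    Continuous (fun v : {v : Fin 3 → ℂ // v ≠ 0} => (Projectivization.mk ℂ v.1 v.2 : CP2)) :=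
  continuous_coinduced_rng

theorem isClosed_vanishing (i : Fin 3) : IsClosed (vanishing i) := by
  rw [← isOpen_compl_iff, isOpen_iff]
  simp only [Set.mem_compl_iff, mk_mem_vanishing]
  exact isOpen_ne_fun ((continuous_apply i).comp continuous_subtype_val) continuous_const

theorem isOpen_dominated (R : ℝ) (i j : Fin 3) : IsOpen (dominated R i j) := by
  rw [isOpen_iff]
  simp only [mk_mem_dominated]
  exact isOpen_lt ((continuous_apply i).comp continuous_subtype_val).norm
    (((continuous_apply j).comp continuous_subtype_val).norm.const_mul R)

theorem dominated_mono {R S : ℝ} (h : R ≤ S) (i j : Fin 3) : dominated R i j ⊆ dominated S i j :=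
  fun p (hp : ‖p.rep i‖ < R * ‖p.rep j‖) =>
    hp.trans_le (mul_le_mul_of_nonneg_right h (norm_nonneg _))

theorem exists_mem_dominated {j : Fin 3} {p : CP2} (hp : p ∉ vanishing j) :
    ∃ n : ℕ, ∀ i, p ∈ dominated n i j := by
  have hpos : 0 < ‖p.rep j‖ := norm_pos_iff.2 hp
  obtain ⟨n, hn⟩ := exists_nat_gt (∑ i, ‖p.rep i‖ / ‖p.rep j‖)
  refine ⟨n, fun i => ?_⟩
  have h : ‖p.rep i‖ / ‖p.rep j‖ ≤ ∑ i, ‖p.rep i‖ / ‖p.rep j‖ :=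
    Finset.single_le_sum (f := fun i => ‖p.rep i‖ / ‖p.rep j‖) (fun i _ => by positivity)
      (Finset.mem_univ i)
  exact (div_lt_iff₀ hpos).1 (h.trans_lt hn)

/-- On a compact set where the `j`-th homogeneous coordinate does not vanish, it bounds the other
coordinates up to a constant. -/
theorem _root_.IsCompact.exists_subset_dominated {K : Set CP2} (hK : IsCompact K) {j : Fin 3}
    (hj : Disjoint K (vanishing j)) : ∃ R : ℝ, 0 < R ∧ ∀ i, K ⊆ dominated R i j := by
  obtain ⟨n, hn⟩ := hK.elim_directed_cover (fun n : ℕ => ⋂ i, dominated n i j)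
    (fun n => isOpen_iInter_of_finite fun i => isOpen_dominated n i j)
    (fun p hp => by
      obtain ⟨n, hn⟩ := exists_mem_dominated (Set.disjoint_left.1 hj hp)
      exact Set.mem_iUnion.2 ⟨n, Set.mem_iInter.2 hn⟩)
    (directed_of_isDirected_le fun m n hmn => Set.iInter_mono fun i =>
      dominated_mono (Nat.cast_le.2 hmn) i j)
  -- Passing from `n` to `n + 1` makes the constant positive.
  refine ⟨n + 1, by positivity, fun i => hn.trans ((Set.iInter_subset _ i).trans ?_)⟩
  exact dominated_mono (by simp) i j

theorem line_e_eq_vanishing {i j k : Fin 3} (hij : i ≠ j) (hik : i ≠ k) (hjk : j ≠ k) :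
    line (e i) (e j) = vanishing k := by
  ext p
  obtain ⟨v, hv, rfl⟩ := exists_mk p
  rw [mk_mem_vanishing, line, SetLike.mem_coe]
  constructor
  · intro h
    have h' := (Projectivization.Subspace.mem_span _).1 h
      (LinearMap.ker (LinearMap.proj k : (Fin 3 → ℂ) →ₗ[ℂ] ℂ)).projectivization (by
        rintro q (rfl | rfl)
        · simp [e, Submodule.mk_mem_projectivization_iff, hik.symm]
        · simp [e, Submodule.mk_mem_projectivization_iff, hjk.symm])
    simpa [Submodule.mk_mem_projectivization_iff] using h'
  · intro hk
    have hsum : v = Pi.single i (v i) + Pi.single j (v j) := by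
      ext l
      have hl : l = i ∨ l = j ∨ l = k := by
        omega
      rcases hl with rfl | rfl | rfl
      · simp [hij]
      · simp [hij.symm]
      · simp [hk, hik.symm, hjk.symm]
    have hsingle : ∀ (l : Fin 3) (c : ℂ) (hc : (Pi.single l c : Fin 3 → ℂ) ≠ 0),
        Projectivization.mk ℂ (Pi.single l c) hc = e l := by
      intro l c hc
      rw [e, Projectivization.mk_eq_mk_iff']
      exact ⟨c, by ext m; simp [Pi.single_apply]⟩
    have hmem : ∀ l, l = i ∨ l = j →
        e l ∈ (Projectivization.Subspace.span {e i, e j} : Projectivization.Subspace ℂ _) := by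
      rintro l (rfl | rfl)
      · exact Projectivization.Subspace.subset_span _ (by simp)
      · exact Projectivization.Subspace.subset_span _ (by simp)
    -- `Subspace.mem_add` needs two nonzero summands, so vanishing coordinates are treated
    -- separately.
    by_cases hi : v i = 0
    · have hvj : v = Pi.single j (v j) := by rw [hi, Pi.single_zero, zero_add] at hsum; exact hsum
      have hne := hv
      rw [hvj] at hne
      have : Projectivization.mk ℂ v hv = e j := by
        rw [← hsingle j (v j) hne]; congr 1
      rw [this]; exact hmem j (Or.inr rfl)
    by_cases hj : v j = 0
    · have hvi : v = Pi.single i (v i) := by rw [hj, Pi.single_zero, add_zero] at hsum; exact hsum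
      have hne := hv
      rw [hvi] at hne
      have : Projectivization.mk ℂ v hv = e i := by
        rw [← hsingle i (v i) hne]; congr 1
      rw [this]; exact hmem i (Or.inl rfl)
    have hi' : (Pi.single i (v i) : Fin 3 → ℂ) ≠ 0 := Pi.single_ne_zero_iff.2 hi
    have hj' : (Pi.single j (v j) : Fin 3 → ℂ) ≠ 0 := Pi.single_ne_zero_iff.2 hj
    have hadd := Projectivization.Subspace.mem_add
      (Projectivization.Subspace.span {e i, e j}) _ _ hi' hj' (by rwa [← hsum])
      (by rw [hsingle]; exact hmem i (Or.inl rfl)) (by rw [hsingle]; exact hmem j (Or.inr rfl))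
    convert hadd

end CP2

/-! ### Accumulation points of orbits -/

namespace Kulkarni

variable {G : Type*} {X : Type*} [Group G] [MulAction G X] [TopologicalSpace X]

/-- The filter is arbitrary so as to cover both sequences in `W` and punctured neighbourhoods of `0`
in `W`. -/
theorem isOrbitAccPt_of_tendsto {K : Set X} {x q : X} (hx : x ∈ K) {ι : Type*} {l : Filter ι}
    [l.NeBot] {g : ι → G} (hg : Tendsto g l cofinite) (hq : Tendsto (fun k => g k • x) l (𝓝 q)) :
    IsOrbitAccPt G K q := by
  intro U hU hfin
  obtain ⟨k, hk, hkU⟩ :=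
    ((hg.eventually hfin.compl_mem_cofinite).and (hq.eventually hU)).exists
  exact hk ⟨x, hx, hkU⟩

theorem IsOrbitAccPt.mem_of_isClosed {K C : Set X} {q : X} (h : IsOrbitAccPt G K q)
    (hC : IsClosed C) (hinv : ∀ (g : G), ∀ x ∈ C, g • x ∈ C) (hK : K ⊆ C) : q ∈ C := by
  by_contra hq
  obtain ⟨g, x, hx, hgx⟩ := (h Cᶜ (hC.isOpen_compl.mem_nhds hq)).nonempty
  exact hgx (hinv g x (hK hx))

/-- A closed invariant set `C` contained in `L0 ∪ L1` is the limit set if `L0 ⊆ C` and orbits of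
compact sets outside `C` accumulate only in `C`. -/
theorem limitSet_eq_of_isClosed {C : Set X} (hC : IsClosed C)
    (hinv : ∀ (g : G), ∀ x ∈ C, g • x ∈ C) (hL0 : L0 G X ⊆ C)
    (hacc : ∀ K : Set X, IsCompact K → Disjoint K C → ∀ q, IsOrbitAccPt G K q → q ∈ C)
    (hsub : C ⊆ L0 G X ∪ L1 G X) : limitSet G X = C := by
  have hL1 : L1 G X ⊆ C := by
    refine closure_minimal ?_ hC
    rintro q ⟨x, -, hq⟩
    by_cases hx : x ∈ C
    · exact hq.mem_of_isClosed hC hinv (Set.singleton_subset_iff.2 hx)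
    · exact hacc {x} isCompact_singleton (Set.disjoint_singleton_left.2 hx) q hq
  have hL2 : L2 G X ⊆ C := by
    refine closure_minimal ?_ hC
    rintro q ⟨K, hK, hKC, hq⟩
    refine hacc K hK (Set.disjoint_left.2 fun x hx hxC => hKC hx (hsub hxC)) q hq
  exact Set.Subset.antisymm (Set.union_subset (Set.union_subset hL0 hL1) hL2)
    (hsub.trans Set.subset_union_left)

end Kulkarni

namespace CaseOne

variable (W : AddSubgroup ℂ) (μ : Multiplicative W →* ℂˣ)

/-! ### The action of `Γ_{W,μ}` in homogeneous coordinates -/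

/-- The element of `Γ_{W,μ}` given by `w`. -/
noncomputable def elt (w : W) : group W μ :=
  ⟨QuotientGroup.mk (toSL W μ (Multiplicative.ofAdd w)), Multiplicative.ofAdd w, rfl⟩

theorem elt_surjective : Function.Surjective (elt W μ) := by
  rintro ⟨_, w, rfl⟩
  exact ⟨w.toAdd, rfl⟩

theorem val_neg (w : W) : val W μ (-w) = (val W μ w)⁻¹ := by simp [val]

theorem elt_add (v w : W) : elt W μ (v + w) = elt W μ v * elt W μ w :=
  Subtype.ext (by simp [elt])

theorem elt_neg (w : W) : elt W μ (-w) = (elt W μ w)⁻¹ :=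
  Subtype.ext (by simp [elt])

theorem elt_nsmul (n : ℕ) (w : W) : elt W μ (n • w) = elt W μ w ^ n :=
  Subtype.ext (by simp [elt])

theorem elt_zsmul (n : ℤ) (w : W) : elt W μ (n • w) = elt W μ w ^ n :=
  Subtype.ext (by simp [elt])

/-- Central elements of `SL(3, ℂ)` are scalar, so the entry `w μ(w)` must vanish. Hence `Γ` is
isomorphic to `W`. -/
theorem eq_zero_of_elt_eq_one {w : W} (h : elt W μ w = 1) : w = 0 := by
  have h1 : (QuotientGroup.mk (toSL W μ (Multiplicative.ofAdd w)) : PSL(3, ℂ)) = 1 :=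
    congrArg Subtype.val h
  rw [QuotientGroup.eq_one_iff, Matrix.SpecialLinearGroup.mem_center_iff] at h1
  obtain ⟨r, -, hr⟩ := h1
  have h2 := congrFun (congrFun hr 1) 2
  have h3 : mat W μ w 1 2 = 0 := h2.symm.trans (by simp)
  replace h3 : (w : ℂ) * val W μ w = 0 := by rw [← h3]; simp [mat]
  exact Subtype.ext ((mul_eq_zero.1 h3).resolve_right (val_ne_zero W μ w))

theorem elt_injective : Function.Injective (elt W μ) := by
  intro v w h
  refine sub_eq_zero.1 (eq_zero_of_elt_eq_one W μ ?_)
  rw [sub_eq_add_neg, elt_add, elt_neg, h, mul_inv_cancel]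

/-- The action of `Γ_{W,μ}` on homogeneous coordinates, up to the factor `μ(w)⁻²`. -/
def move (w : W) (v : Fin 3 → ℂ) : Fin 3 → ℂ :=
  ![v 0, val W μ w ^ 3 * (v 1 + w * v 2), val W μ w ^ 3 * v 2]

theorem mat_mulVec (w : W) (v : Fin 3 → ℂ) :
    (mat W μ w).mulVec v = (val W μ w ^ 2)⁻¹ • move W μ w v := by
  have h := val_ne_zero W μ w
  ext i
  fin_cases i
  · simp [mat, move, Matrix.mulVec, dotProduct, Fin.sum_univ_three]
  · simp [mat, move, Matrix.mulVec, dotProduct, Fin.sum_univ_three]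
    field_simp
  · simp [mat, move, Matrix.mulVec, dotProduct, Fin.sum_univ_three]
    field_simp

theorem move_ne_zero (w : W) {v : Fin 3 → ℂ} (hv : v ≠ 0) : move W μ w v ≠ 0 := by
  intro h
  have h0 := congrFun h 0
  have h1 := congrFun h 1
  have h2 := congrFun h 2
  have hw := val_ne_zero W μ w
  simp only [move, Matrix.cons_val, Pi.zero_apply, mul_eq_zero, pow_eq_zero_iff, ne_eq,
    OfNat.ofNat_ne_zero, not_false_eq_true, hw, false_or] at h0 h1 h2
  apply hv
  ext i
  fin_cases i
  · exact h0
  · simpa [h2] using h1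
  · exact h2

theorem elt_smul_mk (w : W) {v : Fin 3 → ℂ} (hv : v ≠ 0) :
    elt W μ w • (Projectivization.mk ℂ v hv : CP2) =
      Projectivization.mk ℂ (move W μ w v) (move_ne_zero W μ w hv) := by
  have h : elt W μ w • (Projectivization.mk ℂ v hv : CP2) =
      (toSL W μ (Multiplicative.ofAdd w)) • (Projectivization.mk ℂ v hv : CP2) := rfl
  rw [h, Projectivization.matrixSpecialLinearGroup_smul_def, Projectivization.smul_mk,
    Projectivization.mk_eq_mk_iff']
  exact ⟨_, (mat_mulVec W μ w v).symm⟩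

theorem smul_mem_vanishing_two (g : group W μ) {p : CP2} (hp : p ∈ CP2.vanishing 2) :
    g • p ∈ CP2.vanishing 2 := by
  obtain ⟨w, rfl⟩ := elt_surjective W μ g
  obtain ⟨v, hv, rfl⟩ := CP2.exists_mk p
  rw [CP2.mk_mem_vanishing] at hp
  rw [elt_smul_mk, CP2.mk_mem_vanishing]
  simp [move, hp]

theorem smul_mem_vanishing_zero (g : group W μ) {p : CP2} (hp : p ∈ CP2.vanishing 0) :
    g • p ∈ CP2.vanishing 0 := by
  obtain ⟨w, rfl⟩ := elt_surjective W μ g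
  obtain ⟨v, hv, rfl⟩ := CP2.exists_mk p
  rw [CP2.mk_mem_vanishing] at hp
  rw [elt_smul_mk, CP2.mk_mem_vanishing]
  simpa [move] using hp

/-- Only points of the line through `e₁` and `e₂` have non-trivial isotropy groups. -/
theorem L0_subset_vanishing : Kulkarni.L0 (group W μ) CP2 ⊆ CP2.vanishing 2 := by
  refine closure_minimal (fun p hp => ?_) (CP2.isClosed_vanishing 2)
  by_contra hp2
  obtain ⟨v, hv, rfl⟩ := CP2.exists_mk p
  rw [CP2.mk_mem_vanishing] at hp2
  have : Infinite (MulAction.stabilizer (group W μ) (Projectivization.mk ℂ v hv : CP2)) := hp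
  obtain ⟨⟨g, hg⟩, hg1⟩ := exists_ne
    (1 : MulAction.stabilizer (group W μ) (Projectivization.mk ℂ v hv : CP2))
  obtain ⟨w, rfl⟩ := elt_surjective W μ g
  rw [MulAction.mem_stabilizer_iff, elt_smul_mk, Projectivization.mk_eq_mk_iff'] at hg
  obtain ⟨a, ha⟩ := hg
  have h1 := congrFun ha 1
  have h2 := congrFun ha 2
  simp only [Pi.smul_apply, smul_eq_mul, move, Matrix.cons_val] at h1 h2
  have ha : a = val W μ w ^ 3 := mul_right_cancel₀ hp2 h2
  rw [ha] at h1
  have h3 := mul_left_cancel₀ (pow_ne_zero 3 (val_ne_zero W μ w)) h1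
  have hw : (w : ℂ) = 0 := by
    have : (w : ℂ) * v 2 = 0 := by linear_combination -h3
    exact (mul_eq_zero.1 this).resolve_right hp2
  have hw' : w = 0 := Subtype.ext hw
  subst hw'
  exact hg1 (Subtype.ext (by simpa using elt_nsmul W μ 0 0))

/-- The factors `c k` rescale homogeneous coordinates, reducing convergence in the plane to
convergence in `ℂ³`; `v 2 ≠ 0` keeps the starting point outside `L0`. -/
theorem mem_L1 {v u : Fin 3 → ℂ} (hv2 : v 2 ≠ 0) (hv : v ≠ 0) (hu : u ≠ 0) {ι : Type*}
    {l : Filter ι} [l.NeBot] {w : ι → W} (hw : Tendsto w l cofinite) {c : ι → ℂ}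
    (hc : ∀ᶠ k in l, c k ≠ 0) (hlim : Tendsto (fun k => c k • move W μ (w k) v) l (𝓝 u)) :
    (Projectivization.mk ℂ u hu : CP2) ∈ Kulkarni.L1 (group W μ) CP2 := by
  refine subset_closure ⟨Projectivization.mk ℂ v hv, fun h => hv2 ?_, ?_⟩
  · exact (CP2.mk_mem_vanishing 2 hv).1 (L0_subset_vanishing W μ h)
  refine Kulkarni.isOrbitAccPt_of_tendsto (Set.mem_singleton _)
    ((elt_injective W μ).tendsto_cofinite.comp hw) ?_
  classical
  let x : ι → {v : Fin 3 → ℂ // v ≠ 0} := fun k =>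
    if h : c k ≠ 0 then ⟨c k • move W μ (w k) v, smul_ne_zero h (move_ne_zero W μ _ hv)⟩
    else ⟨u, hu⟩
  have hx : ∀ᶠ k in l, (x k : Fin 3 → ℂ) = c k • move W μ (w k) v := by
    filter_upwards [hc] with k hk
    simp [x, hk]
  have hxlim : Tendsto x l (𝓝 ⟨u, hu⟩) :=
    tendsto_subtype_rng.2 (hlim.congr' (hx.mono fun k hk => hk.symm))
  refine ((CP2.continuous_mk.tendsto ⟨u, hu⟩).comp hxlim).congr' ?_
  filter_upwards [hx, hc] with k hk hck
  simp only [Function.comp_apply, elt_smul_mk]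
  rw [Projectivization.mk_eq_mk_iff']
  exact ⟨c k, hk.symm⟩

/-! ### Discreteness of `Γ_{W,μ}` -/

/-- Among infinitely many such `w`, compactness gives a sequence along which `(w, μ(w))` converges,
with nonzero second limit. Consecutive differences then give nontrivial elements of `Γ` tending to
`1`. -/
theorem finite_of_discrete (hdisc : DiscreteTopology (group W μ)) {R : ℝ} (hR : 0 < R) :
    {w : W | ‖(w : ℂ)‖ ≤ R ∧ R⁻¹ ≤ ‖val W μ w‖ ∧ ‖val W μ w‖ ≤ R}.Finite := by
  by_contra hinf
  set S := {w : W | ‖(w : ℂ)‖ ≤ R ∧ R⁻¹ ≤ ‖val W μ w‖ ∧ ‖val W μ w‖ ≤ R}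
  let w : ℕ ↪ S := Set.Infinite.natEmbedding S hinf
  have hK : IsCompact (Metric.closedBall (0 : ℂ) R ×ˢ Metric.closedBall (0 : ℂ) R) :=
    (isCompact_closedBall _ _).prod (isCompact_closedBall _ _)
  obtain ⟨⟨a, b⟩, -, φ, hφ, hlim⟩ := hK.tendsto_subseq
    (x := fun k => (((w k : W) : ℂ), val W μ (w k)))
    (fun k => ⟨by simpa using (w k).2.1, by simpa using (w k).2.2.2⟩)
  have ha : Tendsto (fun k => ((w (φ k) : W) : ℂ)) atTop (𝓝 a) :=
    (continuous_fst.tendsto _).comp hlim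
  have hb : Tendsto (fun k => val W μ (w (φ k))) atTop (𝓝 b) :=
    (continuous_snd.tendsto _).comp hlim
  have hb0 : b ≠ 0 := by
    have : R⁻¹ ≤ ‖b‖ := ge_of_tendsto' hb.norm fun k => (w (φ k)).2.2.1
    exact norm_pos_iff.1 ((inv_pos.2 hR).trans_le this)
  let d : ℕ → W := fun k => (w (φ (k + 1)) : W) + -(w (φ k) : W)
  have hd : Tendsto (fun k => (d k : ℂ)) atTop (𝓝 0) := by
    have := ((tendsto_add_atTop_iff_nat 1).2 ha).sub ha
    simpa [d, sub_eq_add_neg] using this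
  have hvd : Tendsto (fun k => val W μ (d k)) atTop (𝓝 1) := by
    have := ((tendsto_add_atTop_iff_nat 1).2 hb).mul (hb.inv₀ hb0)
    rw [mul_inv_cancel₀ hb0] at this
    simpa [d, val_add, val_neg] using this
  have hmat : Tendsto (fun k => mat W μ (d k)) atTop (𝓝 1) := by
    have h2 : Tendsto (fun k => (val W μ (d k) ^ 2)⁻¹) atTop (𝓝 1) := by
      simpa using (hvd.pow 2).inv₀ (by simp)
    have h3 : Tendsto (fun k => (d k : ℂ) * val W μ (d k)) atTop (𝓝 0) := by
      simpa using hd.mul hvd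
    refine tendsto_pi_nhds.2 fun i => tendsto_pi_nhds.2 fun j => ?_
    fin_cases i <;> fin_cases j <;>
      simp [mat, h2, h3, hvd]
  have hSL : Tendsto (fun k => toSL W μ (Multiplicative.ofAdd (d k))) atTop (𝓝 1) :=
    tendsto_subtype_rng.2 hmat
  have helt : Tendsto (fun k => elt W μ (d k)) atTop (𝓝 1) :=
    tendsto_subtype_rng.2 (((QuotientGroup.continuous_mk
      (N := Subgroup.center SL(3, ℂ))).tendsto 1).comp hSL)
  rw [nhds_discrete, tendsto_pure] at helt
  obtain ⟨k, hk⟩ := helt.exists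
  have h0 := eq_zero_of_elt_eq_one W μ hk
  have h1 : w (φ (k + 1)) = w (φ k) := Subtype.ext (add_neg_eq_zero.1 h0)
  exact absurd (hφ.injective (w.injective h1)) (by simp)

end CaseOne

namespace CaseOne

variable (W : AddSubgroup ℂ) (μ : Multiplicative W →* ℂˣ)

/-! ### Condition (F) -/

/-- `w ↦ log |μ(w)|` as an additive homomorphism. -/
noncomputable def logNorm : W →+ ℝ where
  toFun w := Real.log ‖val W μ w‖
  map_zero' := by simp [val_zero]
  map_add' v w := by
    rw [val_add, norm_mul, Real.log_mul (norm_ne_zero_iff.2 (val_ne_zero W μ v))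
      (norm_ne_zero_iff.2 (val_ne_zero W μ w))]

theorem exp_logNorm (w : W) : Real.exp (logNorm W μ w) = ‖val W μ w‖ :=
  Real.exp_log (norm_pos_iff.2 (val_ne_zero W μ w))

/-- Every lift is `mat w` times a cube root of unity `r`, so its eigenvalues are among `r μ(w)⁻²`
and `r μ(w)`. -/
theorem norm_val_ne_one_of_isLoxodromic {w : W} (h : IsLoxodromic (elt W μ w : PSL(3, ℂ))) :
    ‖val W μ w‖ ≠ 1 := by
  intro h1
  obtain ⟨A, hA, z, hz, hz1⟩ := h
  apply hz1
  have hA' := (QuotientGroup.eq.1 hA.symm)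
  obtain ⟨r, hr3, hr⟩ := Matrix.SpecialLinearGroup.mem_center_iff.1 hA'
  have hrn : ‖r‖ = 1 := by
    refine Complex.norm_eq_one_of_pow_eq_one hr3 (by simp)
  have hAmat : (A : Matrix (Fin 3) (Fin 3) ℂ) = mat W μ w * Matrix.scalar (Fin 3) r := by
    rw [hr]
    have : A = toSL W μ (Multiplicative.ofAdd w) * ((toSL W μ (Multiplicative.ofAdd w))⁻¹ * A) := by
      simp
    exact congrArg Subtype.val this
  obtain ⟨v, hv⟩ := hz.exists_hasEigenvector
  have hAv := hv.apply_eq_smul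
  rw [Matrix.toLin'_apply, hAmat, ← Matrix.mulVec_mulVec] at hAv
  have hs : (Matrix.scalar (Fin 3) r).mulVec v = r • v := by
    ext i
    simp [Matrix.scalar_apply, Matrix.mulVec_diagonal]
  rw [hs, Matrix.mulVec_smul] at hAv
  have e0 : r * ((val W μ w ^ 2)⁻¹ * v 0) = z * v 0 := by
    simpa [mat, Matrix.mulVec, dotProduct, Fin.sum_univ_three] using congrFun hAv 0
  have e1 : r * (val W μ w * v 1 + w * val W μ w * v 2) = z * v 1 := by
    simpa [mat, Matrix.mulVec, dotProduct, Fin.sum_univ_three] using congrFun hAv 1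
  have e2 : r * (val W μ w * v 2) = z * v 2 := by
    simpa [mat, Matrix.mulVec, dotProduct, Fin.sum_univ_three] using congrFun hAv 2
  by_cases h2 : v 2 = 0
  · by_cases hv1 : v 1 = 0
    · have hv0 : v 0 ≠ 0 := by
        intro hv0
        apply hv.2
        ext i
        fin_cases i
        exacts [hv0, hv1, h2]
      have : z = r * (val W μ w ^ 2)⁻¹ := mul_right_cancel₀ hv0 (by rw [← e0, mul_assoc])
      rw [this]
      simp [hrn, h1]
    · have : z = r * val W μ w := mul_right_cancel₀ hv1 (by rw [← e1, h2]; ring)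
      rw [this]
      simp [hrn, h1]
  · have : z = r * val W μ w := mul_right_cancel₀ h2 (by rw [← e2, mul_assoc])
    rw [this]
    simp [hrn, h1]

theorem exists_logNorm_ne_zero (hlox : ∃ g ∈ group W μ, IsLoxodromic g) :
    ∃ u : W, logNorm W μ u ≠ 0 := by
  obtain ⟨g, hg, hlox⟩ := hlox
  obtain ⟨u, hu⟩ := elt_surjective W μ ⟨g, hg⟩
  refine ⟨u, fun h => norm_val_ne_one_of_isLoxodromic W μ (w := u) (by rwa [hu]) ?_⟩
  rw [← exp_logNorm, h, Real.exp_zero]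

/-- The elements `(log |μ(w)|, w)` of `ℝ × ℂ` do not all lie on one real line. -/
theorem exists_not_proportional (hdisc : DiscreteTopology (group W μ))
    (hcyc : ¬ IsCyclic (group W μ)) (u : W) :
    ∃ v : W, (v : ℂ) - ((logNorm W μ v / logNorm W μ u : ℝ) : ℂ) * u ≠ 0 := by
  -- If `logNorm W μ u = 0`, the quotient is `0` by convention and the assumption says `W = 0`; the
  -- argument covers this too.
  by_contra! hprop
  replace hprop : ∀ v : W, (v : ℂ) = ((logNorm W μ v / logNorm W μ u : ℝ) : ℂ) * u :=
    fun v => sub_eq_zero.1 (hprop v)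
  apply hcyc
  have hinj : Function.Injective (logNorm W μ) := by
    intro v w h
    exact Subtype.ext (by rw [hprop v, hprop w, h])
  have hfin : {v : W | |logNorm W μ v| ≤ 1}.Finite := by
    have hR : 0 < max (Real.exp 1) (|logNorm W μ u|⁻¹ * ‖(u : ℂ)‖) :=
      lt_max_of_lt_left (Real.exp_pos 1)
    refine (finite_of_discrete W μ hdisc hR).subset fun v hv => ⟨?_, ?_, ?_⟩
    · refine le_max_of_le_right ?_
      have hv' : |logNorm W μ v| ≤ 1 := hv
      rw [hprop v, norm_mul, Complex.norm_real, Real.norm_eq_abs, abs_div, div_eq_mul_inv]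
      refine mul_le_mul_of_nonneg_right ?_ (norm_nonneg _)
      exact mul_le_of_le_one_left (by positivity) hv'
    · rw [← exp_logNorm]
      refine (inv_anti₀ (Real.exp_pos 1) (le_max_left _ _)).trans ?_
      rw [← Real.exp_neg]
      exact Real.exp_le_exp.2 (abs_le.1 hv).1
    · rw [← exp_logNorm]
      exact (Real.exp_le_exp.2 (abs_le.1 hv).2).trans (le_max_left _ _)
  -- A dense range would still meet `(0, 1)` after removal of the finitely many values in `[-1, 1]`.
  -- So the range is cyclic, and injectivity carries this over to `Γ`.
  rcases (logNorm W μ).range.dense_or_cyclic with hdense | ⟨b, hb⟩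
  · obtain ⟨x, ⟨⟨v, rfl⟩, hx⟩, hxn⟩ := (hdense.sdiff_finite (hfin.image (logNorm W μ))).exists_mem_open
      isOpen_Ioo (Set.nonempty_Ioo.2 (zero_lt_one (α := ℝ)))
    exact (hx ⟨v, abs_le.2 ⟨by linarith [hxn.1], hxn.2.le⟩, rfl⟩).elim
  · have hbmem : b ∈ (logNorm W μ).range := by
      rw [hb]; exact AddSubgroup.subset_closure rfl
    obtain ⟨w₀, rfl⟩ := hbmem
    refine ⟨elt W μ w₀, fun g => ?_⟩
    obtain ⟨w, rfl⟩ := elt_surjective W μ g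
    have hw : logNorm W μ w ∈ AddSubgroup.closure {logNorm W μ w₀} := by
      rw [← hb]; exact ⟨w, rfl⟩
    obtain ⟨n, hn⟩ := AddSubgroup.mem_closure_singleton.1 hw
    refine ⟨n, ?_⟩
    have : n • w₀ = w := hinj (by rw [map_zsmul, hn])
    simp only [← this, elt_zsmul]

/-- Condition (F) follows from discreteness, non-cyclicity and the existence of a loxodromic
element. -/
theorem conditionF (hdisc : DiscreteTopology (group W μ)) (hcyc : ¬ IsCyclic (group W μ))
    (hlox : ∃ g ∈ group W μ, IsLoxodromic g) : ConditionF W μ := by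
  obtain ⟨u, hu⟩ := exists_logNorm_ne_zero W μ hlox
  obtain ⟨v, hv⟩ := exists_not_proportional W μ hdisc hcyc u
  set L := logNorm W μ u with hL
  set r := logNorm W μ v / L with hr
  -- `s n` solves `n exp(3 L s) = 1` for `n > 0`. The integer `m n` brings `τ n = log |μ(w n)| / L`
  -- within `1` of it.
  let s : ℕ → ℝ := fun n => -Real.log n / (3 * L)
  let m : ℕ → ℤ := fun n => ⌊s n - n * r⌋
  let τ : ℕ → ℝ := fun n => m n + n * r
  have hτ : ∀ n, |τ n - s n| ≤ 1 := by
    intro n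
    have h1 := Int.floor_le (s n - n * r)
    have h2 := Int.lt_floor_add_one (s n - n * r)
    rw [abs_le]
    constructor <;> simp only [τ, m] <;> linarith
  let w : ℕ → W := fun n => n • v + m n • u
  have hwτ : ∀ n, (w n : ℂ) = n * ((v : ℂ) - (r : ℂ) * u) + (τ n : ℂ) * u := by
    intro n
    simp only [w, τ, AddSubgroup.coe_add, AddSubgroup.coe_nsmul, AddSubgroup.coe_zsmul,
      nsmul_eq_mul, zsmul_eq_mul]
    push_cast
    ring
  have hlog : ∀ n, logNorm W μ (w n) = τ n * L := by
    intro n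
    simp only [w, τ, map_add, map_nsmul, map_zsmul, nsmul_eq_mul, zsmul_eq_mul, ← hL, hr]
    field_simp
    ring
  have hcast : Tendsto (fun n : ℕ => (n : ℝ)) atTop atTop := tendsto_natCast_atTop_atTop
  have hinv : Tendsto (fun n : ℕ => ((n : ℝ))⁻¹) atTop (𝓝 0) := tendsto_inv_atTop_zero.comp hcast
  have hlogdiv : Tendsto (fun n : ℕ => Real.log n / n) atTop (𝓝 0) :=
    (Real.isLittleO_log_id_atTop.tendsto_div_nhds_zero).comp hcast
  have hτdiv : Tendsto (fun n : ℕ => τ n / n) atTop (𝓝 0) := by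
    have h1 : Tendsto (fun n : ℕ => s n / n) atTop (𝓝 0) := by
      have := hlogdiv.const_mul (-(3 * L)⁻¹)
      rw [mul_zero] at this
      refine this.congr fun n => ?_
      simp only [s]
      ring
    have h2 : Tendsto (fun n : ℕ => (τ n - s n) / n) atTop (𝓝 0) := by
      refine squeeze_zero_norm (fun n => ?_) hinv
      rw [norm_div, Real.norm_eq_abs, Real.norm_natCast, div_eq_mul_inv]
      exact mul_le_of_le_one_left (by positivity) (hτ n)
    have := h1.add h2
    rw [add_zero] at this
    refine this.congr fun n => ?_
    ring
  have hwdiv : Tendsto (fun n : ℕ => (w n : ℂ) / n) atTop (𝓝 ((v : ℂ) - (r : ℂ) * u)) := by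
    have h1 : Tendsto (fun n : ℕ => ((τ n / n : ℝ) : ℂ)) atTop (𝓝 ((0 : ℝ) : ℂ)) :=
      (Complex.continuous_ofReal.tendsto 0).comp hτdiv
    have h2 := (h1.mul_const (u : ℂ)).const_add ((v : ℂ) - (r : ℂ) * u)
    rw [Complex.ofReal_zero, zero_mul, add_zero] at h2
    refine h2.congr' ?_
    filter_upwards [eventually_ne_atTop 0] with n hn
    have hn' : (n : ℂ) ≠ 0 := Nat.cast_ne_zero.2 hn
    rw [hwτ n]
    push_cast
    field_simp
  have hnorm : ∀ n : ℕ, n ≠ 0 → ‖(n : ℂ) * val W μ (w n) ^ 3‖ =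
      Real.exp (3 * L * (τ n - s n)) := by
    intro n hn
    have hn' : (0 : ℝ) < n := Nat.cast_pos.2 (Nat.pos_of_ne_zero hn)
    rw [norm_mul, norm_pow, ← exp_logNorm, hlog, Complex.norm_natCast, ← Real.exp_nat_mul]
    nth_rewrite 1 [← Real.exp_log hn']
    rw [← Real.exp_add]
    congr 1
    simp only [s]
    field_simp
    push_cast
    ring
  have hbound : ∀ n : ℕ, |3 * L * (τ n - s n)| ≤ |3 * L| := by
    intro n
    rw [abs_mul]
    exact mul_le_of_le_one_right (abs_nonneg _) (hτ n)
  -- The moduli lie between `exp(-|3L|)` and `exp |3L|`, but the arguments are uncontrolled, hence a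
  -- subsequence. The shift by one avoids `n = 0`.
  obtain ⟨c, -, φ, hφ, hc⟩ := (isCompact_closedBall (0 : ℂ) (Real.exp |3 * L|)).tendsto_subseq
    (x := fun n : ℕ => ((n + 1 : ℕ) : ℂ) * val W μ (w (n + 1)) ^ 3) (fun n => by
      rw [mem_closedBall_zero_iff, hnorm _ n.succ_ne_zero]
      exact Real.exp_le_exp.2 (abs_le.1 (hbound _)).2)
  have hc0 : c ≠ 0 := by
    have : Real.exp (-|3 * L|) ≤ ‖c‖ := ge_of_tendsto' hc.norm fun n => by
      simp only [Function.comp_apply]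
      rw [hnorm _ (Nat.succ_ne_zero _)]
      exact Real.exp_le_exp.2 (abs_le.1 (hbound _)).1
    exact norm_pos_iff.1 ((Real.exp_pos _).trans_le this)
  let ψ : ℕ → ℕ := fun k => φ k + 1
  have hψ : Tendsto ψ atTop atTop := (tendsto_add_atTop_nat 1).comp hφ.tendsto_atTop
  have hψ0 : ∀ k, (ψ k : ℂ) ≠ 0 := fun k => Nat.cast_ne_zero.2 (Nat.succ_ne_zero _)
  have hc' : Tendsto (fun k => (ψ k : ℂ) * val W μ (w (ψ k)) ^ 3) atTop (𝓝 c) := hc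
  refine ⟨w ∘ ψ, ?_, ?_, _, mul_ne_zero hv hc0, ?_⟩
  · rw [← tendsto_norm_atTop_iff_cobounded]
    refine ((hcast.comp hψ).atTop_mul_pos (norm_pos_iff.2 hv) (hwdiv.comp hψ).norm).congr ?_
    intro k
    have : (ψ k : ℝ) ≠ 0 := Nat.cast_ne_zero.2 (Nat.succ_ne_zero _)
    simp only [Function.comp_apply, norm_div, Complex.norm_natCast]
    field_simp
  · have hinv' : Tendsto (fun k => ((ψ k : ℝ))⁻¹) atTop (𝓝 0) := hinv.comp hψ
    have h3 : Tendsto (fun k => ‖val W μ (w (ψ k))‖ ^ 3) atTop (𝓝 0) := by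
      have := hinv'.mul hc'.norm
      rw [zero_mul] at this
      refine this.congr fun k => ?_
      have : (ψ k : ℝ) ≠ 0 := Nat.cast_ne_zero.2 (Nat.succ_ne_zero _)
      rw [norm_mul, norm_pow, Complex.norm_natCast]
      field_simp
    rw [tendsto_zero_iff_norm_tendsto_zero, Metric.tendsto_nhds]
    intro ε hε
    filter_upwards [h3.eventually (gt_mem_nhds (pow_pos hε 3))] with k hk
    simpa using lt_of_pow_lt_pow_left₀ 3 hε.le hk
  · refine ((hwdiv.comp hψ).mul hc').congr fun k => ?_
    have := hψ0 k
    simp only [Function.comp_apply]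
    field_simp

end CaseOne

namespace CaseOne

variable (W : AddSubgroup ℂ) (μ : Multiplicative W →* ℂˣ)

/-! ### Lower bounds for the limit set -/

/-- Along the sequence of (F), `[a : 0 : 1]` tends to `[a : b : 0]`; varying `a` gives every point
of the line except `e₁`. -/
theorem vanishing_two_subset_L1 (hF : ConditionF W μ) :
    CP2.vanishing 2 ⊆ Kulkarni.L1 (group W μ) CP2 := by
  obtain ⟨w, hw, hμ, b, hb, hlim⟩ := hF
  have hcof : ∀ {w : ℕ → W}, Tendsto (fun k => (w k : ℂ)) atTop (Bornology.cobounded ℂ) →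
      Tendsto w atTop cofinite := by
    intro w hw
    rw [← Subtype.val_injective.comap_cofinite_eq, tendsto_comap_iff]
    exact hw.mono_right (Bornology.le_cofinite ℂ)
  have hμ3 : Tendsto (fun k => val W μ (w k) ^ 3) atTop (𝓝 0) := by simpa using hμ.pow 3
  intro p hp
  obtain ⟨u, hu, rfl⟩ := CP2.exists_mk p
  have hu2 : u 2 = 0 := (CP2.mk_mem_vanishing 2 hu).1 hp
  by_cases hu1 : u 1 = 0
  · have hu0 : u 0 ≠ 0 := by
      intro hu0
      apply hu
      ext i
      fin_cases i
      exacts [hu0, hu1, hu2]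
    have hne : (![1, 0, 1] : Fin 3 → ℂ) ≠ 0 := fun h => one_ne_zero (congrFun h 2)
    -- Doubling `w k` reaches `e₁`: the second coordinate becomes `2 w μ(w)⁶ = 2 (w μ(w)³) μ(w)³`,
    -- which tends to `0`.
    refine mem_L1 W μ (v := ![1, 0, 1]) (by simp) hne hu (w := fun k => w k + w k)
      (c := fun _ => u 0) (hcof ?_) (Eventually.of_forall fun _ => hu0) ?_
    · rw [← tendsto_norm_atTop_iff_cobounded] at hw ⊢
      refine (hw.const_mul_atTop (zero_lt_two (α := ℝ))).congr fun k => ?_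
      rw [AddSubgroup.coe_add, ← two_mul, norm_mul, Complex.norm_ofNat]
    · have h2 := (hμ3.mul hμ3).const_mul (u 0)
      have h1 := ((hlim.mul hμ3).const_mul 2).const_mul (u 0)
      simp only [mul_zero] at h1 h2
      refine tendsto_pi_nhds.2 fun i => ?_
      fin_cases i
      · simp [move]
      · simp only [move, val_add, Fin.mk_one, Pi.smul_apply, Matrix.cons_val, hu1]
        refine h1.congr fun k => ?_
        simp only [smul_eq_mul, AddSubgroup.coe_add]
        ring
      · simp only [move, val_add, Fin.reduceFinMk, Pi.smul_apply, Matrix.cons_val, hu2]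
        refine h2.congr fun k => ?_
        simp only [smul_eq_mul]
        ring
  · have hne : (![u 0 * b / u 1, 0, 1] : Fin 3 → ℂ) ≠ 0 := fun h => one_ne_zero (congrFun h 2)
    refine mem_L1 W μ (v := ![u 0 * b / u 1, 0, 1]) (by simp) hne hu (c := fun _ => u 1 / b)
      (hcof hw) (Eventually.of_forall fun _ => div_ne_zero hu1 hb) ?_
    have h1 := hlim.const_mul (u 1 / b)
    have h2 := hμ3.const_mul (u 1 / b)
    rw [div_mul_cancel₀ _ hb] at h1
    rw [mul_zero] at h2
    refine tendsto_pi_nhds.2 fun i => ?_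
    fin_cases i
    · have : u 1 / b * (u 0 * b / u 1) = u 0 := by field_simp
      simp [move, this]
    · simp only [move, Fin.mk_one, Pi.smul_apply, Matrix.cons_val]
      refine h1.congr fun k => ?_
      simp only [smul_eq_mul]
      ring
    · simp only [move, Fin.reduceFinMk, Pi.smul_apply, Matrix.cons_val, hu2]
      refine h2.congr fun k => ?_
      simp only [smul_eq_mul]
      ring

/-- On `x = 0` the action is the translation of `y/z` by `w`, whatever `μ(w)` is. Letting `w → 0`
with `w ≠ 0` makes the point accumulate at itself. -/
theorem mem_L1_of_mem_vanishing_zero (hW : ¬ DiscreteTopology W) {p : CP2}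
    (hp0 : p ∈ CP2.vanishing 0) (hp2 : p ∉ CP2.vanishing 2) :
    p ∈ Kulkarni.L1 (group W μ) CP2 := by
  have hne : (𝓝[≠] (0 : W)).NeBot := by
    refine ⟨fun h => hW ?_⟩
    exact discreteTopology_of_isOpen_singleton_zero ((isOpen_singleton_iff_punctured_nhds 0).2 h)
  obtain ⟨u, hu, rfl⟩ := CP2.exists_mk p
  rw [CP2.mk_mem_vanishing] at hp0 hp2
  have hid : Tendsto (fun w : W => (w : ℂ)) (𝓝[≠] 0) (𝓝 0) :=
    (continuous_subtype_val.tendsto (0 : W)).mono_left nhdsWithin_le_nhds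
  refine mem_L1 W μ hp2 hu hu (l := 𝓝[≠] 0) (w := id)
    (c := fun w => (val W μ w ^ 3)⁻¹) (tendsto_id.mono_right (nhdsNE_le_cofinite (0 : W)))
    (Eventually.of_forall fun w => inv_ne_zero (pow_ne_zero 3 (val_ne_zero W μ w))) ?_
  have h1 := (hid.mul_const (u 2)).const_add (u 1)
  rw [zero_mul, add_zero] at h1
  refine tendsto_pi_nhds.2 fun i => ?_
  fin_cases i
  · simp [move, hp0]
  · simp only [move, Fin.mk_one, Pi.smul_apply, Matrix.cons_val]
    refine h1.congr fun w => ?_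
    have := val_ne_zero W μ w
    simp only [smul_eq_mul, id]
    field_simp
  · simp only [move, Fin.reduceFinMk, Pi.smul_apply, Matrix.cons_val]
    refine tendsto_const_nhds.congr fun w => ?_
    have := val_ne_zero W μ w
    simp only [smul_eq_mul, id]
    field_simp

/-! ### Upper bounds for the limit set -/

/-- An element moving a point with bounded affine coordinate `y / z` to such a point is a bounded
translation. -/
theorem norm_le_of_mem_dominated {R : ℝ} {w : W} {p : CP2}
    (hp : p ∈ CP2.dominated R 1 2) (hp' : elt W μ w • p ∈ CP2.dominated R 1 2) :
    ‖(w : ℂ)‖ ≤ 2 * R := by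
  obtain ⟨v, hv, rfl⟩ := CP2.exists_mk p
  rw [elt_smul_mk] at hp'
  rw [CP2.mk_mem_dominated] at hp hp'
  simp only [move, Matrix.cons_val, norm_mul] at hp'
  have hν : 0 < ‖val W μ w ^ 3‖ := norm_pos_iff.2 (pow_ne_zero 3 (val_ne_zero W μ w))
  rw [mul_left_comm, mul_lt_mul_iff_right₀ hν] at hp'
  have hv2 : 0 < ‖v 2‖ := by
    refine (norm_nonneg _).lt_of_ne fun h => ?_
    rw [← h, mul_zero] at hp
    exact absurd hp (norm_nonneg _).not_gt
  have htri : ‖(w : ℂ)‖ * ‖v 2‖ ≤ ‖v 1 + w * v 2‖ + ‖v 1‖ := by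
    rw [← norm_mul]
    simpa using norm_sub_le (v 1 + w * v 2) (v 1)
  have : ‖(w : ℂ)‖ * ‖v 2‖ ≤ 2 * R * ‖v 2‖ := by linarith
  exact le_of_mul_le_mul_right this hv2

/-- The element multiplies `z/x` by `μ(w)³`, and `|z/x|` lies between `R⁻¹` and `R` before and
after. -/
theorem norm_val_pow_mem_Icc {R : ℝ} (hR : 0 < R) {w : W} {p : CP2}
    (hp : p ∈ CP2.dominated R 0 2) (hq : p ∈ CP2.dominated R 2 0)
    (hp' : elt W μ w • p ∈ CP2.dominated R 0 2) (hq' : elt W μ w • p ∈ CP2.dominated R 2 0) :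
    (R ^ 2)⁻¹ ≤ ‖val W μ w‖ ^ 3 ∧ ‖val W μ w‖ ^ 3 ≤ R ^ 2 := by
  obtain ⟨v, hv, rfl⟩ := CP2.exists_mk p
  rw [elt_smul_mk] at hp' hq'
  rw [CP2.mk_mem_dominated] at hp hp' hq hq'
  simp only [move, Matrix.cons_val, norm_mul, norm_pow] at hp' hq'
  set ν := ‖val W μ w‖ ^ 3
  have hv2 : 0 < ‖v 2‖ := by
    refine (norm_nonneg _).lt_of_ne fun h => ?_
    rw [← h, mul_zero] at hp
    exact absurd hp (norm_nonneg _).not_gt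
  constructor
  · rw [inv_le_iff_one_le_mul₀ (by positivity)]
    have h1 : ‖v 2‖ < R * (R * (ν * ‖v 2‖)) := hq.trans (mul_lt_mul_of_pos_left hp' hR)
    refine le_of_mul_le_mul_right ?_ hv2
    linarith
  · have h1 : ν * ‖v 2‖ < R * (R * ‖v 2‖) := hq'.trans (mul_lt_mul_of_pos_left hp hR)
    refine le_of_mul_le_mul_right ?_ hv2
    linarith

/-- A set moved into the open set `U` by finitely many elements does not accumulate in `U`. -/
theorem not_isOrbitAccPt_of_finite {K U : Set CP2} (hU : IsOpen U) {q : CP2} (hq : q ∈ U)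
    {S : Set W} (hS : S.Finite) (h : ∀ w, ∀ x ∈ K, elt W μ w • x ∈ U → w ∈ S) :
    ¬ Kulkarni.IsOrbitAccPt (group W μ) K q := by
  intro hacc
  refine hacc U (hU.mem_nhds hq) ((hS.image (elt W μ)).subset ?_)
  rintro g ⟨x, hx, hgx⟩
  obtain ⟨w, rfl⟩ := elt_surjective W μ g
  exact ⟨w, h w x hx hgx, rfl⟩

theorem finite_norm_le [DiscreteTopology W] (R : ℝ) : {w : W | ‖(w : ℂ)‖ ≤ R}.Finite := by
  have h := Metric.finite_isBounded_inter_isClosed (s := (W : Set ℂ)) ⟨inferInstance⟩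
    (Metric.isBounded_closedBall (x := (0 : ℂ)) (r := R)) AddSubgroup.isClosed_of_discrete
  refine (h.preimage Subtype.val_injective.injOn).subset fun w hw => ⟨?_, w.2⟩
  simpa using hw

/-- Off `z = 0`, `y/z` is bounded on `K` and near `q`, so only boundedly large `w` matter, and a
discrete `W` has finitely many. -/
theorem mem_vanishing_of_isOrbitAccPt [DiscreteTopology W] {K : Set CP2} (hK : IsCompact K)
    (hKC : Disjoint K (CP2.vanishing 2)) {q : CP2}
    (hq : Kulkarni.IsOrbitAccPt (group W μ) K q) : q ∈ CP2.vanishing 2 := by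
  by_contra hq2
  obtain ⟨n, hn⟩ := CP2.exists_mem_dominated hq2
  obtain ⟨R, -, hR⟩ := hK.exists_subset_dominated hKC
  refine not_isOrbitAccPt_of_finite W μ (CP2.isOpen_dominated (max R n) 1 2)
    (CP2.dominated_mono (le_max_right _ _) _ _ (hn 1)) (finite_norm_le W (2 * max R n)) ?_ hq
  intro w x hx hwx
  exact norm_le_of_mem_dominated W μ (CP2.dominated_mono (le_max_left _ _) _ _ (hR 1 hx)) hwx

/-- Bounded `w` no longer suffice for finiteness. Avoiding `x = 0` as well bounds `|μ(w)|` on both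
sides, and discreteness of `Γ` replaces that of `W`. -/
theorem mem_vanishing_union_of_isOrbitAccPt (hdisc : DiscreteTopology (group W μ)) {K : Set CP2}
    (hK : IsCompact K) (hKC : Disjoint K (CP2.vanishing 2 ∪ CP2.vanishing 0)) {q : CP2}
    (hq : Kulkarni.IsOrbitAccPt (group W μ) K q) : q ∈ CP2.vanishing 2 ∪ CP2.vanishing 0 := by
  by_contra hq'
  rw [Set.mem_union, not_or] at hq'
  rw [Set.disjoint_union_right] at hKC
  obtain ⟨m, hm⟩ := CP2.exists_mem_dominated hq'.1
  obtain ⟨n, hn⟩ := CP2.exists_mem_dominated hq'.2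
  obtain ⟨R, -, hR⟩ := hK.exists_subset_dominated hKC.1
  obtain ⟨S, -, hS⟩ := hK.exists_subset_dominated hKC.2
  set T : ℝ := max 1 (max (max m n) (max R S)) with hT
  have hT1 : 1 ≤ T := le_max_left _ _
  have hmT : (m : ℝ) ≤ T := by simp [hT]
  have hnT : (n : ℝ) ≤ T := by simp [hT]
  have hRT : R ≤ T := by simp [hT]
  have hST : S ≤ T := by simp [hT]
  have hT2 : 2 * T ≤ 2 * T ^ 2 := by nlinarith
  refine not_isOrbitAccPt_of_finite W μ
    (((CP2.isOpen_dominated T 1 2).inter (CP2.isOpen_dominated T 0 2)).inter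
      (CP2.isOpen_dominated T 2 0))
    ⟨⟨CP2.dominated_mono hmT _ _ (hm 1), CP2.dominated_mono hmT _ _ (hm 0)⟩,
      CP2.dominated_mono hnT _ _ (hn 2)⟩
    -- Since `T ≥ 1`, `2T²` dominates the translation bound `2T`, and its cube dominates the bound
    -- `T²` on `|μ(w)|³` and its inverse.
    (finite_of_discrete W μ hdisc (R := 2 * T ^ 2) (by positivity)) ?_ hq
  rintro w x hx ⟨⟨h1, h2⟩, h3⟩
  obtain ⟨hlow, hup⟩ := norm_val_pow_mem_Icc W μ (by positivity)
    (CP2.dominated_mono hRT _ _ (hR 0 hx)) (CP2.dominated_mono hST _ _ (hS 2 hx)) h2 h3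
  have hS1 : 1 ≤ 2 * T ^ 2 := by nlinarith
  refine ⟨(norm_le_of_mem_dominated W μ (CP2.dominated_mono hRT _ _ (hR 1 hx)) h1).trans hT2,
    ?_, ?_⟩
  · refine le_of_pow_le_pow_left₀ (n := 3) (by simp) (norm_nonneg _) (le_trans ?_ hlow)
    rw [inv_pow]
    refine inv_anti₀ (by positivity) (le_trans ?_ (le_self_pow₀ hS1 (by simp)))
    nlinarith
  · refine le_of_pow_le_pow_left₀ (n := 3) (by simp) (by positivity) (hup.trans ?_)
    refine le_trans ?_ (le_self_pow₀ hS1 (by simp))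
    nlinarith

/-! ### The limit set -/

theorem limitSet_of_discrete [DiscreteTopology W] (hF : ConditionF W μ) :
    Kulkarni.limitSet (group W μ) CP2 = CP2.line (CP2.e 0) (CP2.e 1) := by
  rw [CP2.line_e_eq_vanishing (k := 2) (by decide) (by decide) (by decide)]
  exact Kulkarni.limitSet_eq_of_isClosed (CP2.isClosed_vanishing 2)
    (fun g x hx => smul_mem_vanishing_two W μ g hx) (L0_subset_vanishing W μ)
    (fun K hK hKC q hq => mem_vanishing_of_isOrbitAccPt W μ hK hKC hq)
    ((vanishing_two_subset_L1 W μ hF).trans Set.subset_union_right)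

theorem limitSet_of_not_discrete (hdisc : DiscreteTopology (group W μ))
    (hW : ¬ DiscreteTopology W) (hF : ConditionF W μ) :
    Kulkarni.limitSet (group W μ) CP2 =
      CP2.line (CP2.e 0) (CP2.e 1) ∪ CP2.line (CP2.e 1) (CP2.e 2) := by
  rw [CP2.line_e_eq_vanishing (k := 2) (by decide) (by decide) (by decide),
    CP2.line_e_eq_vanishing (k := 0) (by decide) (by decide) (by decide)]
  refine Kulkarni.limitSet_eq_of_isClosed
    ((CP2.isClosed_vanishing 2).union (CP2.isClosed_vanishing 0)) ?_
    ((L0_subset_vanishing W μ).trans Set.subset_union_left)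
    (fun K hK hKC q hq => mem_vanishing_union_of_isOrbitAccPt W μ hdisc hK hKC hq) ?_
  · rintro g x (hx | hx)
    · exact Or.inl (smul_mem_vanishing_two W μ g hx)
    · exact Or.inr (smul_mem_vanishing_zero W μ g hx)
  · intro p hp
    by_cases hp2 : p ∈ CP2.vanishing 2
    · exact Or.inr (vanishing_two_subset_L1 W μ hF hp2)
    · exact Or.inr (mem_L1_of_mem_vanishing_zero W μ hW (hp.resolve_left hp2) hp2)

end CaseOne

/-- The Kulkarni limit set of `Γ_{W,μ}`. Under the standing hypotheses condition (F) always holds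
(`CaseOne.conditionF`), so the limit set is one line or two lines according to whether `W` is
discrete. -/
theorem mainTheorem5 (W : AddSubgroup ℂ) (μ : Multiplicative W →* ℂˣ)
    (hdisc : DiscreteTopology (CaseOne.group W μ))
    (hcyc : ¬ IsCyclic (CaseOne.group W μ))
    (hlox : ∃ g ∈ CaseOne.group W μ, IsLoxodromic g) :
    ((CaseOne.C13 W μ ∨ CaseOne.C14 W μ) ∧ ¬ CaseOne.ConditionF W μ →
      Kulkarni.limitSet (CaseOne.group W μ) CP2 = {CP2.e 0, CP2.e 1}) ∧
    (((CaseOne.C13 W μ ∨ CaseOne.C14 W μ) ∧ CaseOne.ConditionF W μ) ∨ CaseOne.C11 W μ →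
      Kulkarni.limitSet (CaseOne.group W μ) CP2 = CP2.line (CP2.e 0) (CP2.e 1)) ∧
    ((CaseOne.C15 W μ ∨ CaseOne.C16 W μ) ∧ ¬ CaseOne.ConditionF W μ →
      Kulkarni.limitSet (CaseOne.group W μ) CP2 =
        {CP2.e 0} ∪ CP2.line (CP2.e 1) (CP2.e 2)) ∧
    (((CaseOne.C15 W μ ∨ CaseOne.C16 W μ) ∧ CaseOne.ConditionF W μ) ∨ CaseOne.C12 W μ →
      Kulkarni.limitSet (CaseOne.group W μ) CP2 =
        CP2.line (CP2.e 0) (CP2.e 1) ∪ CP2.line (CP2.e 1) (CP2.e 2)) := by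
  have hF := CaseOne.conditionF W μ hdisc hcyc hlox
  refine ⟨fun h => absurd hF h.2, fun h => ?_, fun h => absurd hF h.2, fun h => ?_⟩
  · have hW : DiscreteTopology W := by
      rcases h with ⟨h | h, -⟩ | h
      exacts [h.2.1, h.2.1, h.2]
    exact CaseOne.limitSet_of_discrete W μ hF
  · have hW : ¬ DiscreteTopology W := by
      rcases h with ⟨h | h, -⟩ | h
      exacts [h.2.1, h.2.1, h.2]
    exact CaseOne.limitSet_of_not_discrete W μ hdisc hW hF
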